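/- There is an absolute constant $c>0$ such that the following holds. Let $N \ge 1$ and let $A$ be an $N \times n$ real random matrix whose rows $A_1,\dots,A_N$ are independent random vectors in $\mathbb{R}^n$ with a common second moment matrix $\Sigma = \mathbb{E}\, A_i \otimes A_i$ (i.e. $\Sigma_{jk} = \mathbb{E}\,(A_i)_j (A_i)_k$ for every $i$). Let $m \ge 0$ be a number such that $\|A_i\|_2 \le \sqrt{m}$ almost surely for all $i$. Then for every $t \ge 0$, with probability at least $1 - \max(n,2)\cdot\exp(-ct^2)$ (so at least $1 - n\cdot\exp(-ct^2)$ whenever $n \ge 2$), one has $$\Big\| \frac{1}{N} A^*A - \Sigma \Big\| \le \max\big(\|\Sigma\|^{1/2}\delta,\ \delta^2\big), \qquad \text{where } \delta = t\sqrt{\frac{m}{N}}.$$ Moreover, whenever this inequality holds for a realization of $A$, that realization satisfies $$\|A\| \le \|\Sigma\|^{1/2}\sqrt{N} + t\sqrt{m}.$$ Here $\|\cdot\|$ denotes the spectral (operator) norm of a matrix and $\|\cdot\|_2$ the Euclidean norm. -/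

import Mathlib

open MeasureTheory ProbabilityTheory
open scoped Matrix Matrix.Norms.L2Operator

noncomputable section

/-- The `i`-th row of a random `N × n` real matrix, as a random vector in Euclidean space `ℝⁿ`. -/
def randomRow {Ω : Type*} {N n : ℕ} (A : Ω → Matrix (Fin N) (Fin n) ℝ) (i : Fin N) :
    Ω → EuclideanSpace ℝ (Fin n) :=
  fun ω => WithLp.toLp 2 (A ω i)

/-- The second moment matrix `𝔼 X ⊗ X` of a random vector `X` in `ℝⁿ`:
its `(j, k)` entry is `𝔼 (X_j X_k)`. -/
def secondMomentMatrix {Ω : Type*} [MeasurableSpace Ω] {n : ℕ} (P : Measure Ω)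
    (X : Ω → EuclideanSpace ℝ (Fin n)) : Matrix (Fin n) (Fin n) ℝ :=
  Matrix.of fun j k => ∫ ω, X ω j * X ω k ∂P

end

/-! Write `X_i = a_i a_iᵀ - S`, `Z = ∑ X_i`, `K = m N ‖S‖` and `Q(θ) = 𝔼 tr exp(θZ)`. The proof
bounds `Q` by a matrix Chernoff argument driven by a differential inequality, so that neither
Golden–Thompson nor Lieb concavity is needed.

One has `Q'(θ) = ∑ 𝔼 tr X_i exp(θZ)`. Let `Z_i` be `Z` without its `i`-th summand. As `X_i` is
centred and independent of `Z_i`, subtracting `exp(θZ_i)` costs nothing, and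
`trace_sub_mul_exp_sub_exp_le` bounds `θ tr X_i (exp(θZ) - exp(θZ_i))` by `θ² tr X_i² (exp(θZ) +
exp(θZ_i))`. The `Z_i` term is at most `θ² m‖S‖ Q`, by independence, `𝔼 X_i² ≤ m‖S‖` and Klein's
inequality. The `Z` term is handled by the pointwise self-bound `∑ X_i² ≤ 2m Z + 4K`
(`posSemidef_self_bound`), whose first summand brings back `Q'`. Absorbing it for `4mθ ≤ 1` gives
`θQ' ≤ 10 K θ² Q` (`mul_deriv_traceMgf_le`), hence `Q(±θ) ≤ n exp(5Kθ²)` for `θ ≥ 0`.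

Markov's inequality with an optimised `θ` yields the tail `2n exp(-t²/20)`; halving the exponent
turns the prefactor into `max(n,2)`. The bound on `‖A‖` is deterministic, from `‖AᴴA‖ = ‖A‖²`. -/

namespace Matrix

/-! ### Trace inequalities for exponentials of Hermitian matrices -/

variable {n : ℕ}

/-- A real Hermitian matrix is orthogonally diagonalizable. -/
lemma IsHermitian.exists_eq_conj_diagonal {A : Matrix (Fin n) (Fin n) ℝ} (hA : A.IsHermitian) :
    ∃ (U : Matrix (Fin n) (Fin n) ℝ) (a : Fin n → ℝ), U * Uᴴ = 1 ∧ Uᴴ * U = 1 ∧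
      A = U * diagonal a * Uᴴ := by
  refine ⟨hA.eigenvectorUnitary, hA.eigenvalues, ?_, ?_, ?_⟩
  · exact Unitary.coe_mul_star_self hA.eigenvectorUnitary
  · exact Unitary.coe_star_mul_self hA.eigenvectorUnitary
  · have := hA.spectral_theorem
    rw [Unitary.conjStarAlgAut_apply] at this
    exact this

lemma exp_conj_diagonal {U : Matrix (Fin n) (Fin n) ℝ} (h1 : U * Uᴴ = 1) (a : Fin n → ℝ) :
    NormedSpace.exp (U * diagonal a * Uᴴ) = U * diagonal (fun i => Real.exp (a i)) * Uᴴ := by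
  have hU : U⁻¹ = Uᴴ := inv_eq_right_inv h1
  have hu : IsUnit U := (Units.mkOfMulEqOne U Uᴴ h1).isUnit
  rw [← hU, exp_conj _ _ hu, exp_diagonal]
  congr 3
  ext i
  rw [Pi.coe_exp, Real.exp_eq_exp_ℝ]

lemma conj_diagonal_mul {U : Matrix (Fin n) (Fin n) ℝ} (h2 : Uᴴ * U = 1) (a b : Fin n → ℝ) :
    (U * diagonal a * Uᴴ) * (U * diagonal b * Uᴴ) = U * diagonal (fun i => a i * b i) * Uᴴ := by
  rw [← diagonal_mul_diagonal]
  simp only [Matrix.mul_assoc]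
  rw [← Matrix.mul_assoc Uᴴ U, h2, Matrix.one_mul]

/-- The trace of a product of functions of two Hermitian matrices is a double spectral sum. -/
lemma trace_conj_diagonal_mul (U V : Matrix (Fin n) (Fin n) ℝ) (f g : Fin n → ℝ) :
    ((U * diagonal f * Uᴴ) * (V * diagonal g * Vᴴ)).trace =
      ∑ i, ∑ j, f i * g j * ((Uᴴ * V) i j) ^ 2 := by
  have : ((U * diagonal f * Uᴴ) * (V * diagonal g * Vᴴ)).trace =
      (diagonal f * (Uᴴ * V) * (diagonal g * (Uᴴ * V)ᴴ)).trace := by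
    rw [conjTranspose_mul, conjTranspose_conjTranspose]
    simp only [Matrix.mul_assoc]
    rw [trace_mul_comm]
    simp only [Matrix.mul_assoc]
  rw [this]
  simp only [trace, diag_apply, mul_apply (M := diagonal f * (Uᴴ * V)), diagonal_mul,
    conjTranspose_apply, star_trivial]
  refine Finset.sum_congr rfl fun i _ => Finset.sum_congr rfl fun j _ => by ring

lemma trace_conj_diagonal {U : Matrix (Fin n) (Fin n) ℝ} (h2 : Uᴴ * U = 1) (f : Fin n → ℝ) :
    (U * diagonal f * Uᴴ).trace = ∑ i, f i := by
  rw [trace_mul_comm, ← Matrix.mul_assoc, h2, Matrix.one_mul, trace_diagonal]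

lemma conj_diagonal_one {U : Matrix (Fin n) (Fin n) ℝ} (h1 : U * Uᴴ = 1) :
    U * diagonal (fun _ => (1 : ℝ)) * Uᴴ = 1 := by
  rw [diagonal_one, Matrix.mul_one, h1]

/-- By convexity the difference quotient of `exp` is at most its value at the larger endpoint; using
the sum of both values keeps the bound symmetric. -/
lemma exp_diff_le (x y : ℝ) :
    (x - y) * (Real.exp x - Real.exp y) ≤ (x - y) ^ 2 * (Real.exp x + Real.exp y) := by
  wlog h : y ≤ x generalizing x y
  · have := this y x (le_of_not_ge h)
    linarith
  have h1 : Real.exp x - Real.exp y ≤ (x - y) * Real.exp x := by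
    have h2 := Real.add_one_le_exp (y - x)
    have h3 : Real.exp y = Real.exp x * Real.exp (y - x) := by
      rw [← Real.exp_add]; congr 1; ring
    nlinarith [Real.exp_pos x]
  have h4 := mul_le_mul_of_nonneg_left h1 (sub_nonneg.2 h)
  have h5 := mul_nonneg (sq_nonneg (x - y)) (Real.exp_pos y).le
  linarith

/-- Mean value inequality for the trace exponential. -/
lemma trace_sub_mul_exp_sub_exp_le {A B : Matrix (Fin n) (Fin n) ℝ} (hA : A.IsHermitian)
    (hB : B.IsHermitian) :
    ((A - B) * (NormedSpace.exp A - NormedSpace.exp B)).trace ≤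
      (((A - B) * (A - B)) * (NormedSpace.exp A + NormedSpace.exp B)).trace := by
  obtain ⟨U, a, hU1, hU2, rfl⟩ := hA.exists_eq_conj_diagonal
  obtain ⟨V, b, hV1, hV2, rfl⟩ := hB.exists_eq_conj_diagonal
  set A := U * diagonal a * Uᴴ with hAdef
  set B := V * diagonal b * Vᴴ with hBdef
  set eA := NormedSpace.exp A with heA
  set eB := NormedSpace.exp B with heB
  set w : Fin n → Fin n → ℝ := fun i j => ((Uᴴ * V) i j) ^ 2 with hw
  have heA' : eA = U * diagonal (fun i => Real.exp (a i)) * Uᴴ := exp_conj_diagonal hU1 a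
  have heB' : eB = V * diagonal (fun i => Real.exp (b i)) * Vᴴ := exp_conj_diagonal hV1 b
  have key : ∀ f g : Fin n → ℝ, ((U * diagonal f * Uᴴ) * (V * diagonal g * Vᴴ)).trace =
      ∑ i, ∑ j, f i * g j * w i j := trace_conj_diagonal_mul U V
  -- Pairing with the identity, written in the other eigenbasis, gives single traces the same
  -- weights `w`.
  have kA : ∀ f : Fin n → ℝ, (U * diagonal f * Uᴴ).trace = ∑ i, ∑ j, f i * w i j := by
    intro f
    have := key f (fun _ => 1)
    rw [conj_diagonal_one hV1, Matrix.mul_one] at this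
    simpa using this
  have kB : ∀ g : Fin n → ℝ, (V * diagonal g * Vᴴ).trace = ∑ i, ∑ j, g j * w i j := by
    intro g
    have := key (fun _ => 1) g
    rw [conj_diagonal_one hU1, Matrix.one_mul] at this
    simpa using this
  have t1 : ((A - B) * (eA - eB)).trace =
      (A * eA).trace - (A * eB).trace - (eA * B).trace + (B * eB).trace := by
    rw [trace_mul_comm eA B]
    simp only [Matrix.sub_mul, Matrix.mul_sub, trace_sub]
    ring
  -- Cyclicity, and commutation of each matrix with its own exponential, rewrite every mixed term as
  -- a function of `A` times a function of `B`.
  have t2 : (((A - B) * (A - B)) * (eA + eB)).trace =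
      ((A * A) * eA).trace - 2 * ((A * eA) * B).trace + (eA * (B * B)).trace +
      ((A * A) * eB).trace - 2 * (A * (B * eB)).trace + ((B * B) * eB).trace := by
    have c1 : A * eA = eA * A := by
      rw [heA', hAdef, conj_diagonal_mul hU2, conj_diagonal_mul hU2]
      simp only [mul_comm]
    have c2 : B * eB = eB * B := by
      rw [heB', hBdef, conj_diagonal_mul hV2, conj_diagonal_mul hV2]
      simp only [mul_comm]
    have e1 : (A * (B * eA)).trace = (A * (eA * B)).trace := by
      rw [trace_mul_comm, Matrix.mul_assoc, ← c1, trace_mul_comm, Matrix.mul_assoc]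
    have e2 : (B * (A * eA)).trace = (A * (eA * B)).trace := by
      rw [trace_mul_comm, Matrix.mul_assoc]
    have e3 : (B * (A * eB)).trace = (A * (B * eB)).trace := by
      rw [trace_mul_comm, Matrix.mul_assoc, c2]
    have e4 : (eA * (B * B)).trace = (B * (B * eA)).trace := by
      rw [trace_mul_comm, Matrix.mul_assoc]
    simp only [Matrix.sub_mul, Matrix.mul_sub, Matrix.mul_add, trace_sub, trace_add,
      Matrix.mul_assoc]
    rw [e1, e2, e3, e4]
    ring
  rw [t1, t2, heA', heB', hAdef, hBdef]
  simp only [conj_diagonal_mul hU2, conj_diagonal_mul hV2, key, kA, kB]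
  simp only [Finset.mul_sum, ← Finset.sum_add_distrib, ← Finset.sum_sub_distrib]
  -- The weights are nonnegative, so the scalar inequality for each pair of eigenvalues suffices.
  refine Finset.sum_le_sum fun i _ => Finset.sum_le_sum fun j _ => ?_
  have hw0 : 0 ≤ w i j := sq_nonneg _
  have := mul_le_mul_of_nonneg_right (exp_diff_le (a i) (b j)) hw0
  linarith

/-- Klein's inequality for the trace exponential. -/
lemma trace_exp_add_le {A B : Matrix (Fin n) (Fin n) ℝ} (hA : A.IsHermitian)
    (hB : B.IsHermitian) :
    (NormedSpace.exp A).trace + ((B - A) * NormedSpace.exp A).trace ≤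
      (NormedSpace.exp B).trace := by
  obtain ⟨U, a, hU1, hU2, rfl⟩ := hA.exists_eq_conj_diagonal
  obtain ⟨V, b, hV1, hV2, rfl⟩ := hB.exists_eq_conj_diagonal
  rw [exp_conj_diagonal hU1, exp_conj_diagonal hV1, Matrix.sub_mul, trace_sub,
    trace_mul_comm (V * _ * _)]
  have key := trace_conj_diagonal_mul U V
  have kA : ∀ f : Fin n → ℝ, (U * diagonal f * Uᴴ).trace =
      ∑ i, ∑ j, f i * ((Uᴴ * V) i j) ^ 2 := by
    intro f
    have := key f (fun _ => 1)
    rw [conj_diagonal_one hV1, Matrix.mul_one] at this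
    simpa using this
  have kB : ∀ g : Fin n → ℝ, (V * diagonal g * Vᴴ).trace =
      ∑ i, ∑ j, g j * ((Uᴴ * V) i j) ^ 2 := by
    intro g
    have := key (fun _ => 1) g
    rw [conj_diagonal_one hU1, Matrix.one_mul] at this
    simpa using this
  simp only [conj_diagonal_mul hU2, key, kA, kB]
  simp only [← Finset.sum_add_distrib, ← Finset.sum_sub_distrib]
  refine Finset.sum_le_sum fun i _ => Finset.sum_le_sum fun j _ => ?_
  -- The tangent line to `exp` at `a i` lies below its graph.
  have h1 : Real.exp (a i) * (1 + (b j - a i)) ≤ Real.exp (b j) := by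
    have := Real.add_one_le_exp (b j - a i)
    calc _ ≤ Real.exp (a i) * Real.exp (b j - a i) := by gcongr; linarith
      _ = _ := by rw [← Real.exp_add]; congr 1; ring
  have := mul_le_mul_of_nonneg_right h1 (sq_nonneg ((Uᴴ * V) i j))
  linarith

lemma exp_eq_half_mul_half (A : Matrix (Fin n) (Fin n) ℝ) :
    NormedSpace.exp A =
      NormedSpace.exp ((1 / 2 : ℝ) • A) * NormedSpace.exp ((1 / 2 : ℝ) • A) := by
  rw [← exp_add_of_commute _ _ (Commute.refl _), ← add_smul]
  norm_num

/-- By cyclicity this is the trace of the congruence of `M` by the Hermitian matrix `exp (A/2)`. -/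
lemma PosSemidef.trace_mul_exp_nonneg {A M : Matrix (Fin n) (Fin n) ℝ} (hM : M.PosSemidef)
    (hA : A.IsHermitian) : 0 ≤ (M * NormedSpace.exp A).trace := by
  have hh : (NormedSpace.exp ((1 / 2 : ℝ) • A)).IsHermitian :=
    IsHermitian.exp (hA.smul (by rw [isSelfAdjoint_iff]; simp))
  have := (hM.mul_mul_conjTranspose_same (NormedSpace.exp ((1 / 2 : ℝ) • A))).trace_nonneg
  rw [hh.eq, Matrix.mul_assoc, trace_mul_comm, Matrix.mul_assoc, ← exp_eq_half_mul_half] at this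
  exact this

lemma trace_mul_exp_le {A M M' : Matrix (Fin n) (Fin n) ℝ} (hM : (M' - M).PosSemidef)
    (hA : A.IsHermitian) :
    (M * NormedSpace.exp A).trace ≤ (M' * NormedSpace.exp A).trace := by
  have := hM.trace_mul_exp_nonneg hA
  rw [Matrix.sub_mul, trace_sub] at this
  linarith

lemma trace_exp_nonneg {A : Matrix (Fin n) (Fin n) ℝ} (hA : A.IsHermitian) :
    0 ≤ (NormedSpace.exp A).trace := by
  simpa using PosSemidef.one.trace_mul_exp_nonneg hA

/-- If the operator norm of a Hermitian matrix exceeds `s`, then one of the two trace exponentials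
is at least `exp (θ s)`. -/
lemma exp_le_trace_exp_add_trace_exp {Z : Matrix (Fin n) (Fin n) ℝ} (hZ : Z.IsHermitian)
    {s θ : ℝ} (hθ : 0 ≤ θ) (hs : 0 ≤ s) (h : s < ‖Z‖) :
    Real.exp (θ * s) ≤
      (NormedSpace.exp (θ • Z)).trace + (NormedSpace.exp ((-θ) • Z)).trace := by
  obtain ⟨U, a, hU1, hU2, rfl⟩ := hZ.exists_eq_conj_diagonal
  have hs1 : ∀ r : ℝ, r • (U * diagonal a * Uᴴ) = U * diagonal (fun i => r * a i) * Uᴴ := by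
    intro r
    rw [← Matrix.smul_mul, ← Matrix.mul_smul, ← diagonal_smul]; rfl
  have hUn : ‖U‖ ≤ 1 := by
    have h3 := l2_opNorm_conjTranspose_mul_self U
    rw [hU2] at h3
    have h4 : ‖(1 : Matrix (Fin n) (Fin n) ℝ)‖ ≤ 1 := by
      rw [← diagonal_one, l2_opNorm_diagonal]
      exact (pi_norm_le_iff_of_nonneg zero_le_one).2 (by simp)
    nlinarith [norm_nonneg U]
  obtain ⟨i, hi⟩ : ∃ i, s < |a i| := by
    by_contra! hc
    have h5 : ‖a‖ ≤ s := (pi_norm_le_iff_of_nonneg hs).2 (by simpa using hc)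
    have h6 : ‖U * diagonal a * Uᴴ‖ ≤ s := by
      calc _ ≤ ‖U‖ * ‖diagonal a‖ * ‖Uᴴ‖ :=
            (norm_mul_le _ _).trans (by gcongr; exact norm_mul_le _ _)
        _ ≤ 1 * s * 1 := by
            rw [l2_opNorm_conjTranspose, l2_opNorm_diagonal]
            gcongr
        _ = s := by ring
    linarith
  rw [hs1, hs1, exp_conj_diagonal hU1, exp_conj_diagonal hU1, trace_conj_diagonal hU2,
    trace_conj_diagonal hU2]
  have g1 : Real.exp (θ * a i) ≤ ∑ i, Real.exp (θ * a i) :=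
    Finset.single_le_sum (f := fun i => Real.exp (θ * a i))
      (fun _ _ => (Real.exp_pos _).le) (Finset.mem_univ i)
  have g2 : Real.exp (-θ * a i) ≤ ∑ i, Real.exp (-θ * a i) :=
    Finset.single_le_sum (f := fun i => Real.exp (-θ * a i))
      (fun _ _ => (Real.exp_pos _).le) (Finset.mem_univ i)
  have p1 := Real.exp_pos (θ * a i)
  have p2 := Real.exp_pos (-θ * a i)
  rcases le_abs.1 hi.le with h7 | h7
  · have : Real.exp (θ * s) ≤ Real.exp (θ * a i) := by gcongr
    linarith
  · have : Real.exp (θ * s) ≤ Real.exp (-θ * a i) := by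
      apply Real.exp_le_exp.2; nlinarith
    linarith

end Matrix

/-! ### Loewner order bounds and rank-one matrices -/

namespace Matrix

variable {n : ℕ}

lemma IsHermitian.posSemidef_mul_self {M : Matrix (Fin n) (Fin n) ℝ} (hM : M.IsHermitian) :
    (M * M).PosSemidef := by
  have := posSemidef_conjTranspose_mul_self M
  rwa [hM.eq] at this

lemma IsHermitian.posSemidef_norm_smul_one_sub {M : Matrix (Fin n) (Fin n) ℝ}
    (hM : M.IsHermitian) : (‖M‖ • (1 : Matrix (Fin n) (Fin n) ℝ) - M).PosSemidef := by
  refine PosSemidef.of_dotProduct_mulVec_nonneg ?_ fun x => ?_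
  · exact (isHermitian_one.smul (by rw [isSelfAdjoint_iff]; simp)).sub hM
  · have h1 := real_inner_le_norm (WithLp.toLp 2 x) (WithLp.toLp 2 (M *ᵥ x))
    have h2 := l2_opNorm_mulVec M (WithLp.toLp 2 x)
    have h3 : inner ℝ (WithLp.toLp 2 x) (WithLp.toLp 2 (M *ᵥ x)) = x ⬝ᵥ (M *ᵥ x) := by
      rw [EuclideanSpace.inner_toLp_toLp, dotProduct_comm]; simp
    have h4 : ‖WithLp.toLp 2 x‖ ^ 2 = x ⬝ᵥ x := by
      rw [← real_inner_self_eq_norm_sq, EuclideanSpace.inner_toLp_toLp]; simp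
    rw [sub_mulVec, smul_mulVec, one_mulVec, dotProduct_sub, dotProduct_smul, star_trivial,
      ← h3, ← h4, smul_eq_mul]
    have h5 : ‖WithLp.toLp 2 (M *ᵥ x)‖ ≤ ‖M‖ * ‖WithLp.toLp 2 x‖ := h2
    nlinarith [mul_le_mul_of_nonneg_left h5 (norm_nonneg (WithLp.toLp 2 x))]

/-- The rank-one matrix `v vᵀ`. -/
def outer (v : EuclideanSpace ℝ (Fin n)) : Matrix (Fin n) (Fin n) ℝ := vecMulVec v.ofLp v.ofLp

lemma outer_apply (v : EuclideanSpace ℝ (Fin n)) (j k : Fin n) : outer v j k = v j * v k := rfl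

lemma isHermitian_outer (v : EuclideanSpace ℝ (Fin n)) : (outer v).IsHermitian := by
  ext j k; simp [outer_apply, mul_comm]

lemma continuous_outer : Continuous (outer : EuclideanSpace ℝ (Fin n) → _) := by
  refine continuous_matrix fun j k => ?_
  simp only [outer_apply]
  fun_prop

lemma outer_mul_outer (v : EuclideanSpace ℝ (Fin n)) : outer v * outer v = ‖v‖ ^ 2 • outer v := by
  rw [EuclideanSpace.real_norm_sq_eq]
  ext j k
  simp only [mul_apply, outer_apply, smul_apply, smul_eq_mul, Finset.sum_mul]
  exact Finset.sum_congr rfl fun i _ => by ring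

lemma posSemidef_outer (v : EuclideanSpace ℝ (Fin n)) : (outer v).PosSemidef := by
  simpa [outer] using posSemidef_vecMulVec_self_star v.ofLp

lemma posSemidef_smul_outer_sub {v : EuclideanSpace ℝ (Fin n)} {m : ℝ} (hv : ‖v‖ ≤ √m)
    (hm : 0 ≤ m) : (m • outer v - outer v * outer v).PosSemidef := by
  rw [outer_mul_outer, ← sub_smul]
  refine (posSemidef_outer v).smul (sub_nonneg.2 ?_)
  calc ‖v‖ ^ 2 ≤ √m ^ 2 := by gcongr
    _ = m := Real.sq_sqrt hm

end Matrix

/-! ### Expectations of matrix functions of bounded independent rows -/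

namespace RandomRows
open Matrix

variable {Ω : Type*} [MeasurableSpace Ω] {P : Measure Ω} {n N : ℕ}

lemma linearMap_integral {F : Type*} [NormedAddCommGroup F] [NormedSpace ℝ F] [CompleteSpace F]
    (L : Matrix (Fin n) (Fin n) ℝ →ₗ[ℝ] F) {M : Ω → Matrix (Fin n) (Fin n) ℝ}
    (hM : Integrable M P) : L (∫ ω, M ω ∂P) = ∫ ω, L (M ω) ∂P :=
  (L.toContinuousLinearMap.integral_comp_comm hM).symm

lemma integral_entry {M : Ω → Matrix (Fin n) (Fin n) ℝ} (hM : Integrable M P) (j k : Fin n) :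
    (∫ ω, M ω ∂P) j k = ∫ ω, M ω j k ∂P :=
  linearMap_integral (entryLinearMap ℝ ℝ j k) hM

/-- For fixed `x` the quadratic form is linear in the matrix, so it commutes with the integral. -/
lemma posSemidef_integral {M : Ω → Matrix (Fin n) (Fin n) ℝ} (hM : Integrable M P)
    (h : ∀ᵐ ω ∂P, (M ω).PosSemidef) : (∫ ω, M ω ∂P).PosSemidef := by
  refine PosSemidef.of_dotProduct_mulVec_nonneg ?_ fun x => ?_
  · ext j k
    rw [conjTranspose_apply, star_trivial, integral_entry hM, integral_entry hM]
    refine integral_congr_ae ?_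
    filter_upwards [h] with ω hω
    simpa using hω.isHermitian.apply j k
  · let L : Matrix (Fin n) (Fin n) ℝ →ₗ[ℝ] ℝ :=
      { toFun := fun A => star x ⬝ᵥ (A *ᵥ x)
        map_add' := fun A B => by rw [add_mulVec, dotProduct_add]
        map_smul' := fun r A => by rw [smul_mulVec, dotProduct_smul]; rfl }
    have : star x ⬝ᵥ ((∫ ω, M ω ∂P) *ᵥ x) = ∫ ω, star x ⬝ᵥ (M ω *ᵥ x) ∂P :=
      linearMap_integral L hM
    rw [this]
    refine integral_nonneg_of_ae ?_
    filter_upwards [h] with ω hω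
    exact hω.dotProduct_mulVec_nonneg x

/-- The set of tuples of rows of norm at most `√m` is compact. -/
lemma isCompact_rows (m : ℝ) :
    IsCompact {y : Fin N → EuclideanSpace ℝ (Fin n) | ∀ i, ‖y i‖ ≤ √m} := by
  have : {y : Fin N → EuclideanSpace ℝ (Fin n) | ∀ i, ‖y i‖ ≤ √m} =
      Set.univ.pi fun _ => Metric.closedBall 0 (√m) := by
    ext y; simp
  rw [this]
  exact isCompact_univ_pi fun _ => isCompact_closedBall _ _

variable {a : Fin N → Ω → EuclideanSpace ℝ (Fin n)} {m : ℝ}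

lemma aestronglyMeasurable_comp_rows {F : Type*} [NormedAddCommGroup F]
    [SecondCountableTopology F] (ha : ∀ i, Measurable (a i))
    {φ : (Fin N → EuclideanSpace ℝ (Fin n)) → F} (hφ : Continuous φ) :
    AEStronglyMeasurable (fun ω => φ fun i => a i ω) P :=
  (hφ.stronglyMeasurable.comp_measurable (measurable_pi_lambda _ ha)).aestronglyMeasurable

variable [IsProbabilityMeasure P]

/-- Continuous functions of bounded random rows are integrable. -/
lemma integrable_comp_rows {F : Type*} [NormedAddCommGroup F]
    [SecondCountableTopology F] (ha : ∀ i, Measurable (a i))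
    (hb : ∀ᵐ ω ∂P, ∀ i, ‖a i ω‖ ≤ √m)
    {φ : (Fin N → EuclideanSpace ℝ (Fin n)) → F} (hφ : Continuous φ) :
    Integrable (fun ω => φ fun i => a i ω) P := by
  obtain ⟨C, hC⟩ := (isCompact_rows (N := N) (n := n) m).exists_bound_of_continuousOn hφ.continuousOn
  refine Integrable.of_bound (aestronglyMeasurable_comp_rows ha hφ) C ?_
  filter_upwards [hb] with ω hω
  exact hC _ hω

/-- In the expected trace of a product, a factor independent of the other one can be replaced by
its expectation. -/
lemma integral_trace_mul_of_indep (ha : ∀ i, Measurable (a i))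
    (hb : ∀ᵐ ω ∂P, ∀ i, ‖a i ω‖ ≤ √m) (hind : iIndepFun a P) (i : Fin N)
    {φ : EuclideanSpace ℝ (Fin n) → Matrix (Fin n) (Fin n) ℝ} (hφ : Continuous φ)
    {ψ : (Fin N → EuclideanSpace ℝ (Fin n)) → Matrix (Fin n) (Fin n) ℝ} (hψ : Continuous ψ)
    (hψi : ∀ y, ψ (Function.update y i 0) = ψ y) :
    ∫ ω, (φ (a i ω) * ψ fun j => a j ω).trace ∂P =
      ∫ ω, ((∫ ω', φ (a i ω') ∂P) * ψ fun j => a j ω).trace ∂P := by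
  classical
  have hφc : Continuous fun y : Fin N → EuclideanSpace ℝ (Fin n) => φ (y i) :=
    hφ.comp (continuous_apply i)
  have hφint : Integrable (fun ω => φ (a i ω)) P := integrable_comp_rows ha hb hφc
  have hentry : ∀ j k, Continuous fun M : Matrix (Fin n) (Fin n) ℝ => M j k :=
    fun j k => continuous_id.matrix_elem j k
  simp only [trace, diag_apply, mul_apply]
  have hi1 : ∀ j k, Integrable (fun ω => φ (a i ω) j k * (ψ fun l => a l ω) k j) P := fun j k =>
    integrable_comp_rows ha hb (φ := fun y => φ (y i) j k * ψ y k j)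
      (((hentry j k).comp hφc).mul ((hentry k j).comp hψ))
  have hi2 : ∀ j k, Integrable (fun ω => (∫ ω', φ (a i ω') ∂P) j k * (ψ fun l => a l ω) k j) P :=
    fun j k => integrable_comp_rows ha hb (φ := fun y => (∫ ω', φ (a i ω') ∂P) j k * ψ y k j)
      (continuous_const.mul ((hentry k j).comp hψ))
  rw [integral_finsetSum _ fun j _ => integrable_finsetSum _ fun k _ => hi1 j k,
    integral_finsetSum _ fun j _ => integrable_finsetSum _ fun k _ => hi2 j k]
  refine Finset.sum_congr rfl fun j _ => ?_
  rw [integral_finsetSum _ fun k _ => hi1 j k, integral_finsetSum _ fun k _ => hi2 j k]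
  refine Finset.sum_congr rfl fun k _ => ?_
  rw [integral_const_mul, integral_entry hφint]
  let f : (↥({i} : Finset (Fin N)) → EuclideanSpace ℝ (Fin n)) → ℝ :=
    fun x => φ (x ⟨i, Finset.mem_singleton_self i⟩) j k
  -- Filling the missing row with `0`, as in `hψi`, exhibits `ψ` as a function of the other rows
  -- alone.
  let e : (↥(Finset.univ.erase i : Finset (Fin N)) → EuclideanSpace ℝ (Fin n)) →
      Fin N → EuclideanSpace ℝ (Fin n) :=
    fun z l => if h : l ∈ Finset.univ.erase i then z ⟨l, h⟩ else 0
  have he : Continuous e := by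
    refine continuous_pi fun l => ?_
    by_cases h : l ∈ Finset.univ.erase i
    · simpa only [e, dif_pos h] using continuous_apply _
    · simpa only [e, dif_neg h] using continuous_const
  have hee : ∀ ω, ψ (e fun l => a l ω) = ψ fun l => a l ω := by
    intro ω
    rw [← hψi fun l => a l ω]
    congr 1
    ext1 l
    by_cases h : l = i
    · subst h; simp [e]
    · simp [e, h]
  have hfm : Continuous f := (hentry j k).comp (hφ.comp (continuous_apply _))
  have hgm : Continuous fun z => ψ (e z) k j := (hentry k j).comp (hψ.comp he)
  have := (hind.indepFun_finset {i} (Finset.univ.erase i) (by simp) ha).integral_fun_comp_mul_comp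
    (f := f) (g := fun z => ψ (e z) k j)
    (measurable_pi_lambda _ fun l : ↥({i} : Finset (Fin N)) => ha l.1).aemeasurable
    (measurable_pi_lambda _ fun l : ↥(Finset.univ.erase i : Finset (Fin N)) => ha l.1).aemeasurable
    hfm.stronglyMeasurable.aestronglyMeasurable hgm.stronglyMeasurable.aestronglyMeasurable
  simpa only [f, hee] using this

end RandomRows

/-! ### The centred Gram matrix, its trace generating function and variance bounds -/

namespace RandomRows
open Matrix

variable {n N : ℕ}

/-- The centred Gram matrix `∑ᵢ (yᵢ yᵢᵀ - S)`. -/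
def centredGram (S : Matrix (Fin n) (Fin n) ℝ) (y : Fin N → EuclideanSpace ℝ (Fin n)) :
    Matrix (Fin n) (Fin n) ℝ := ∑ i, (outer (y i) - S)

/-- The centred Gram matrix with the `i`-th row left out. -/
def centredGramErase (S : Matrix (Fin n) (Fin n) ℝ) (i : Fin N)
    (y : Fin N → EuclideanSpace ℝ (Fin n)) : Matrix (Fin n) (Fin n) ℝ :=
  ∑ j ∈ Finset.univ.erase i, (outer (y j) - S)

lemma centredGramErase_update (S : Matrix (Fin n) (Fin n) ℝ) (i : Fin N)
    (y : Fin N → EuclideanSpace ℝ (Fin n)) :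
    centredGramErase S i (Function.update y i 0) = centredGramErase S i y :=
  Finset.sum_congr rfl fun j hj => by rw [Function.update_of_ne (Finset.ne_of_mem_erase hj)]

lemma centredGram_eq (S : Matrix (Fin n) (Fin n) ℝ) (i : Fin N)
    (y : Fin N → EuclideanSpace ℝ (Fin n)) :
    centredGram S y = (outer (y i) - S) + centredGramErase S i y :=
  (Finset.add_sum_erase _ (fun i => outer (y i) - S) (Finset.mem_univ i)).symm

lemma continuous_outer_apply (i : Fin N) :
    Continuous fun y : Fin N → EuclideanSpace ℝ (Fin n) => outer (y i) :=
  continuous_outer.comp (continuous_apply i)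

lemma continuous_centredGram (S : Matrix (Fin n) (Fin n) ℝ) :
    Continuous (centredGram (N := N) S) :=
  continuous_finsetSum _ fun i _ => (continuous_outer_apply i).sub continuous_const

lemma continuous_centredGramErase (S : Matrix (Fin n) (Fin n) ℝ) (i : Fin N) :
    Continuous (centredGramErase S i) :=
  continuous_finsetSum _ fun i _ => (continuous_outer_apply i).sub continuous_const

lemma isHermitian_sum {S : Matrix (Fin n) (Fin n) ℝ} (hS : S.IsHermitian) (s : Finset (Fin N))
    (y : Fin N → EuclideanSpace ℝ (Fin n)) : (∑ i ∈ s, (outer (y i) - S)).IsHermitian := by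
  rw [IsHermitian, conjTranspose_sum]
  exact Finset.sum_congr rfl fun i _ => ((isHermitian_outer _).sub hS).eq

lemma IsHermitian.real_smul {M : Matrix (Fin n) (Fin n) ℝ} (hM : M.IsHermitian) (θ : ℝ) :
    (θ • M).IsHermitian := hM.smul (by rw [isSelfAdjoint_iff]; simp)

lemma continuous_exp_matrix :
    Continuous (NormedSpace.exp : Matrix (Fin n) (Fin n) ℝ → Matrix (Fin n) (Fin n) ℝ) :=
  letI : NormedAlgebra ℚ (Matrix (Fin n) (Fin n) ℝ) := NormedAlgebra.restrictScalars ℚ ℝ _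
  NormedSpace.exp_continuous

lemma hasDerivAt_trace_exp_smul (Z : Matrix (Fin n) (Fin n) ℝ) (θ : ℝ) :
    HasDerivAt (fun u : ℝ => (NormedSpace.exp (u • Z)).trace)
      (Z * NormedSpace.exp (θ • Z)).trace θ :=
  HasFDerivAt.comp_hasDerivAt (f := fun u : ℝ => NormedSpace.exp (u • Z)) θ
    (traceLinearMap (Fin n) ℝ ℝ).toContinuousLinearMap.hasFDerivAt
    (hasDerivAt_exp_smul_const' (𝕂 := ℝ) Z θ)

variable {Ω : Type*} [MeasurableSpace Ω] {P : Measure Ω} [IsProbabilityMeasure P]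
  {a : Fin N → Ω → EuclideanSpace ℝ (Fin n)} {m : ℝ} {S : Matrix (Fin n) (Fin n) ℝ}

/-- The trace moment generating function of the centred Gram matrix. -/
noncomputable def traceMgf (P : Measure Ω) (a : Fin N → Ω → EuclideanSpace ℝ (Fin n))
    (S : Matrix (Fin n) (Fin n) ℝ) (θ : ℝ) : ℝ :=
  ∫ ω, (NormedSpace.exp (θ • centredGram S fun i => a i ω)).trace ∂P

/-- Differentiation under the expectation for continuous functions of bounded random rows. -/
lemma hasDerivAt_integral_comp_rows (ha : ∀ i, Measurable (a i))
    (hb : ∀ᵐ ω ∂P, ∀ i, ‖a i ω‖ ≤ √m) {f f' : ℝ → (Fin N → EuclideanSpace ℝ (Fin n)) → ℝ}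
    (hf : ∀ θ, Continuous (f θ))
    (hf' : Continuous fun p : ℝ × (Fin N → EuclideanSpace ℝ (Fin n)) => f' p.1 p.2)
    (hd : ∀ θ y, HasDerivAt (fun u => f u y) (f' θ y) θ) (θ : ℝ) :
    HasDerivAt (fun u => ∫ ω, f u (fun i => a i ω) ∂P) (∫ ω, f' θ (fun i => a i ω) ∂P) θ := by
  -- Compactness in both the parameter and the rows supplies a constant dominating function.
  obtain ⟨C, hC⟩ := ((isCompact_closedBall θ 1).prod
    (isCompact_rows (N := N) (n := n) m)).exists_bound_of_continuousOn hf'.continuousOn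
  have hf'θ : Continuous (f' θ) := hf'.comp (continuous_const.prodMk continuous_id)
  refine (hasDerivAt_integral_of_dominated_loc_of_deriv_le (bound := fun _ => C)
    (F := fun u ω => f u (fun i => a i ω)) (F' := fun u ω => f' u (fun i => a i ω))
    (Metric.closedBall_mem_nhds θ one_pos) (.of_forall fun θ' =>
      aestronglyMeasurable_comp_rows ha (hf θ')) (integrable_comp_rows ha hb (hf θ))
    (aestronglyMeasurable_comp_rows ha hf'θ) ?_ (integrable_const C)
    (.of_forall fun ω θ' _ => hd θ' _)).2
  filter_upwards [hb] with ω hω θ' hθ'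
  exact hC (θ', fun i => a i ω) ⟨hθ', hω⟩

lemma continuous_trace_mul_exp {Y : Type*} [TopologicalSpace Y]
    {X W : Y → Matrix (Fin n) (Fin n) ℝ} (hX : Continuous X) (hW : Continuous W) :
    Continuous fun y => (X y * NormedSpace.exp (W y)).trace :=
  (hX.matrix_mul (continuous_exp_matrix.comp hW)).matrix_trace

lemma continuous_trace_exp {Y : Type*} [TopologicalSpace Y]
    {W : Y → Matrix (Fin n) (Fin n) ℝ} (hW : Continuous W) :
    Continuous fun y => (NormedSpace.exp (W y)).trace :=
  (continuous_exp_matrix.comp hW).matrix_trace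

lemma hasDerivAt_traceMgf (ha : ∀ i, Measurable (a i)) (hb : ∀ᵐ ω ∂P, ∀ i, ‖a i ω‖ ≤ √m) (θ : ℝ) :
    HasDerivAt (traceMgf P a S)
      (∫ ω, (centredGram S (fun i => a i ω) *
        NormedSpace.exp (θ • centredGram S fun i => a i ω)).trace ∂P) θ := by
  have h1 : Continuous fun p : ℝ × (Fin N → EuclideanSpace ℝ (Fin n)) => centredGram S p.2 :=
    (continuous_centredGram S).comp continuous_snd
  exact hasDerivAt_integral_comp_rows ha hb
    (f := fun θ y => (NormedSpace.exp (θ • centredGram S y)).trace)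
    (f' := fun θ y => (centredGram S y * NormedSpace.exp (θ • centredGram S y)).trace)
    (fun θ => continuous_trace_exp ((continuous_centredGram S).const_smul θ))
    (continuous_trace_mul_exp h1 (continuous_fst.smul h1))
    (fun θ y => hasDerivAt_trace_exp_smul _ _) θ

lemma isHermitian_second_moment (ha : ∀ i, Measurable (a i))
    (hb : ∀ᵐ ω ∂P, ∀ i, ‖a i ω‖ ≤ √m) (i : Fin N)
    (hS : ∫ ω, outer (a i ω) ∂P = S) : S.IsHermitian := by
  rw [← hS]
  exact (posSemidef_integral (integrable_comp_rows ha hb (continuous_outer_apply i))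
    (.of_forall fun ω => posSemidef_outer _)).isHermitian

/-- `𝔼 (aaᵀ - S)² + S² ≤ m S`. -/
lemma posSemidef_variance_bound (hm : 0 ≤ m) (ha : ∀ i, Measurable (a i))
    (hb : ∀ᵐ ω ∂P, ∀ i, ‖a i ω‖ ≤ √m) (i : Fin N) (hS : ∫ ω, outer (a i ω) ∂P = S) :
    (m • S - (∫ ω, (outer (a i ω) - S) * (outer (a i ω) - S) ∂P) - S * S).PosSemidef := by
  have hco := continuous_outer_apply (n := n) i
  have i1 : Integrable (fun ω => outer (a i ω)) P := integrable_comp_rows ha hb hco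
  have i2 : Integrable (fun ω => outer (a i ω) * outer (a i ω)) P :=
    integrable_comp_rows ha hb (hco.mul hco)
  have e1 : ∫ ω, (outer (a i ω) - S) * (outer (a i ω) - S) ∂P =
      (∫ ω, outer (a i ω) * outer (a i ω) ∂P) - S * S := by
    have : ∀ ω, (outer (a i ω) - S) * (outer (a i ω) - S) =
        outer (a i ω) * outer (a i ω) - outer (a i ω) * S - S * outer (a i ω) + S * S :=
      fun ω => by noncomm_ring
    simp only [this]
    have i3 : Integrable (fun ω => outer (a i ω) * S) P := i1.mul_const S
    have i4 : Integrable (fun ω => S * outer (a i ω)) P := i1.const_mul S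
    have i5 : Integrable (fun ω => outer (a i ω) * outer (a i ω) - outer (a i ω) * S) P := i2.sub i3
    have i6 : Integrable (fun ω => outer (a i ω) * outer (a i ω) - outer (a i ω) * S -
      S * outer (a i ω)) P := i5.sub i4
    have e3 : ∫ ω, outer (a i ω) * S ∂P = S * S :=
      (linearMap_integral (LinearMap.mulRight ℝ S) i1).symm.trans (by simp [hS])
    have e4 : ∫ ω, S * outer (a i ω) ∂P = S * S :=
      (linearMap_integral (LinearMap.mulLeft ℝ S) i1).symm.trans (by simp [hS])
    rw [integral_add i6 (integrable_const _), integral_sub i5 i4, integral_sub i2 i3, e3, e4]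
    simp
  -- The `S * S` cancels, leaving the mean of `m aaᵀ - (aaᵀ)²`, positive semidefinite since `(aaᵀ)²
  -- = ‖a‖² aaᵀ`.
  have e2 : m • S - (∫ ω, (outer (a i ω) - S) * (outer (a i ω) - S) ∂P) - S * S =
      ∫ ω, (m • outer (a i ω) - outer (a i ω) * outer (a i ω)) ∂P := by
    have i7 : Integrable (fun ω => m • outer (a i ω)) P := i1.smul m
    rw [e1, integral_sub i7 i2, integral_smul, hS]
    abel
  rw [e2]
  refine posSemidef_integral ((i1.smul m).sub i2) ?_
  filter_upwards [hb] with ω hω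
  exact posSemidef_smul_outer_sub (hω i) hm

lemma posSemidef_integral_sq (ha : ∀ i, Measurable (a i))
    (hb : ∀ᵐ ω ∂P, ∀ i, ‖a i ω‖ ≤ √m) (i : Fin N) (hS : S.IsHermitian) :
    (∫ ω, (outer (a i ω) - S) * (outer (a i ω) - S) ∂P).PosSemidef := by
  have hco := (continuous_outer_apply (n := n) i).sub (continuous_const (y := S))
  exact posSemidef_integral (integrable_comp_rows ha hb (hco.mul hco))
    (.of_forall fun ω => ((isHermitian_outer _).sub hS).posSemidef_mul_self)

/-- `𝔼 (aaᵀ - S)² ≤ m ‖S‖`. -/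
lemma posSemidef_norm_sub_variance (hm : 0 ≤ m) (ha : ∀ i, Measurable (a i))
    (hb : ∀ᵐ ω ∂P, ∀ i, ‖a i ω‖ ≤ √m) (i : Fin N) (hS : ∫ ω, outer (a i ω) ∂P = S) :
    ((m * ‖S‖) • (1 : Matrix (Fin n) (Fin n) ℝ) -
      (∫ ω, (outer (a i ω) - S) * (outer (a i ω) - S) ∂P)).PosSemidef := by
  have hH := isHermitian_second_moment ha hb i hS
  -- With `V` the variance: `m‖S‖ - V = m(‖S‖ - S) + (mS - V - S²) + S²`.
  convert! ((hH.posSemidef_norm_smul_one_sub.smul hm).add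
    (posSemidef_variance_bound hm ha hb i hS)).add hH.posSemidef_mul_self using 1
  rw [smul_sub, smul_smul]
  abel

/-- `S² ≤ m ‖S‖`. -/
lemma posSemidef_norm_sub_sq (hm : 0 ≤ m) (ha : ∀ i, Measurable (a i))
    (hb : ∀ᵐ ω ∂P, ∀ i, ‖a i ω‖ ≤ √m) (i : Fin N) (hS : ∫ ω, outer (a i ω) ∂P = S) :
    ((m * ‖S‖) • (1 : Matrix (Fin n) (Fin n) ℝ) - S * S).PosSemidef := by
  have hH := isHermitian_second_moment ha hb i hS
  convert! ((hH.posSemidef_norm_smul_one_sub.smul hm).add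
    (posSemidef_variance_bound hm ha hb i hS)).add (posSemidef_integral_sq ha hb i hH) using 1
  rw [smul_sub, smul_smul]
  abel

/-- The sum of squares of the centred rank-one matrices is controlled by their sum. -/
lemma posSemidef_self_bound (hm : 0 ≤ m) (hH : S.IsHermitian)
    (hSS : ((m * ‖S‖) • (1 : Matrix (Fin n) (Fin n) ℝ) - S * S).PosSemidef)
    {y : Fin N → EuclideanSpace ℝ (Fin n)} (hy : ∀ i, ‖y i‖ ≤ √m) :
    ((2 * m) • centredGram S y + (4 * (m * N * ‖S‖)) • (1 : Matrix (Fin n) (Fin n) ℝ) -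
      ∑ i, (outer (y i) - S) * (outer (y i) - S)).PosSemidef := by
  have key : ∀ i, ((2 * m) • (outer (y i) - S) + (4 * (m * ‖S‖)) • (1 : Matrix (Fin n) (Fin n) ℝ) -
      (outer (y i) - S) * (outer (y i) - S)).PosSemidef := by
    intro i
    have h1 := (posSemidef_smul_outer_sub (hy i) hm).smul (zero_le_two (α := ℝ))
    have h2 := hSS.smul (zero_le_two (α := ℝ))
    have h3 := ((isHermitian_outer (y i)).add hH).posSemidef_mul_self
    have h4 := hH.posSemidef_norm_smul_one_sub.smul (mul_nonneg zero_le_two hm)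
    -- With `H = yyᵀ`, the identity `(H - S)² = 2H² + 2S² - (H + S)²` makes the claim the sum of
    -- `2(mH - H²)`, `2(m‖S‖ - S²)`, `(H + S)²` and `2m(‖S‖ - S)`.
    convert! ((h1.add h2).add h3).add h4 using 1
    generalize outer (y i) = H
    have e1 : (H - S) * (H - S) = (2 : ℝ) • (H * H) + (2 : ℝ) • (S * S) - (H + S) * (H + S) := by
      simp only [two_smul]; noncomm_ring
    rw [e1]
    module
  have hsum : (∑ i, ((2 * m) • (outer (y i) - S) +
      (4 * (m * ‖S‖)) • (1 : Matrix (Fin n) (Fin n) ℝ) -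
      (outer (y i) - S) * (outer (y i) - S))).PosSemidef :=
    posSemidef_sum _ fun i _ => key i
  convert! hsum using 1
  rw [Finset.sum_sub_distrib, Finset.sum_add_distrib, ← Finset.smul_sum, centredGram]
  congr 2
  rw [Finset.sum_const, Finset.card_univ, Fintype.card_fin, ← Nat.cast_smul_eq_nsmul ℝ, smul_smul]
  congr 1; ring

end RandomRows

/-! ### The differential inequality and the Chernoff bound -/

namespace RandomRows
open Matrix

variable {n N : ℕ} {Ω : Type*} [MeasurableSpace Ω] {P : Measure Ω} [IsProbabilityMeasure P]
  {a : Fin N → Ω → EuclideanSpace ℝ (Fin n)} {m : ℝ} {S : Matrix (Fin n) (Fin n) ℝ}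

/-- The mean value inequality applies to two exponents differing by exactly `θ X_i`. -/
lemma trace_leave_one_out_le (hH : S.IsHermitian) (θ : ℝ) (i : Fin N)
    (y : Fin N → EuclideanSpace ℝ (Fin n)) :
    θ * ((outer (y i) - S) * NormedSpace.exp (θ • centredGram S y)).trace -
      θ * ((outer (y i) - S) * NormedSpace.exp (θ • centredGramErase S i y)).trace ≤
    θ ^ 2 * ((outer (y i) - S) * (outer (y i) - S) *
        NormedSpace.exp (θ • centredGram S y)).trace +
      θ ^ 2 * ((outer (y i) - S) * (outer (y i) - S) *
        NormedSpace.exp (θ • centredGramErase S i y)).trace := by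
  have hZ : (centredGram S y).IsHermitian := isHermitian_sum hH _ y
  have hW : (centredGramErase S i y).IsHermitian := isHermitian_sum hH _ y
  have h := trace_sub_mul_exp_sub_exp_le (IsHermitian.real_smul hZ θ) (IsHermitian.real_smul hW θ)
  have e : θ • centredGram S y - θ • centredGramErase S i y = θ • (outer (y i) - S) := by
    rw [centredGram_eq S i y, ← smul_sub, add_sub_cancel_right]
  rw [e] at h
  generalize outer (y i) - S = X at h ⊢
  simp only [Matrix.smul_mul, Matrix.mul_smul, trace_smul, smul_eq_mul, Matrix.mul_sub,
    Matrix.mul_add, trace_sub, trace_add] at h ⊢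
  linarith

/-- Leaving one row out does not increase the trace moment generating function. -/
lemma integral_trace_exp_erase_le (ha : ∀ i, Measurable (a i))
    (hb : ∀ᵐ ω ∂P, ∀ i, ‖a i ω‖ ≤ √m) (hind : iIndepFun a P) (θ : ℝ) (i : Fin N)
    (hS : ∫ ω, outer (a i ω) ∂P = S) :
    ∫ ω, (NormedSpace.exp (θ • centredGramErase S i fun j => a j ω)).trace ∂P ≤
      traceMgf P a S θ ∧
    ∫ ω, ((outer (a i ω) - S) *
      NormedSpace.exp (θ • centredGramErase S i fun j => a j ω)).trace ∂P = 0 := by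
  have hH := isHermitian_second_moment ha hb i hS
  have cX : Continuous fun v : EuclideanSpace ℝ (Fin n) => outer v - S :=
    continuous_outer.sub continuous_const
  have cXi : Continuous fun y : Fin N → EuclideanSpace ℝ (Fin n) => outer (y i) - S :=
    (continuous_outer_apply i).sub continuous_const
  have cZ := (continuous_centredGram (N := N) S).const_smul θ
  have cW := (continuous_centredGramErase S i).const_smul θ
  have hX0 : ∫ ω, (outer (a i ω) - S) ∂P = 0 := by
    rw [integral_sub (integrable_comp_rows ha hb (continuous_outer_apply i))
      (integrable_const _), hS]
    simp
  have hzero : ∫ ω, ((outer (a i ω) - S) *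
      NormedSpace.exp (θ • centredGramErase S i fun j => a j ω)).trace ∂P = 0 := by
    have := integral_trace_mul_of_indep ha hb hind i cX
      (ψ := fun y => NormedSpace.exp (θ • centredGramErase S i y))
      (continuous_exp_matrix.comp cW) (fun y => by rw [centredGramErase_update])
    rw [this, hX0]
    simp
  refine ⟨?_, hzero⟩
  have j1 : Integrable (fun ω => (NormedSpace.exp (θ • centredGramErase S i
      fun j => a j ω)).trace) P := integrable_comp_rows ha hb (continuous_trace_exp cW)
  have j2 : Integrable (fun ω => ((outer (a i ω) - S) *
      NormedSpace.exp (θ • centredGramErase S i fun j => a j ω)).trace) P :=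
    integrable_comp_rows ha hb (continuous_trace_mul_exp cXi cW)
  have j3 : Integrable (fun ω => (NormedSpace.exp (θ • centredGram S
      fun j => a j ω)).trace) P := integrable_comp_rows ha hb (continuous_trace_exp cZ)
  have hmono := integral_mono (j1.add (j2.const_mul θ)) j3 fun ω => by
    have hZ : (centredGram S fun j => a j ω).IsHermitian := isHermitian_sum hH _ _
    have hW : (centredGramErase S i fun j => a j ω).IsHermitian := isHermitian_sum hH _ _
    -- Klein's inequality expanded at the leave-one-out exponent: its linear term has mean zero by
    -- `hzero`.
    have h := trace_exp_add_le (IsHermitian.real_smul hW θ) (IsHermitian.real_smul hZ θ)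
    have e : θ • (centredGram S fun j => a j ω) - θ • (centredGramErase S i fun j => a j ω) =
        θ • (outer (a i ω) - S) := by
      rw [centredGram_eq S i, ← smul_sub, add_sub_cancel_right]
    rw [e, Matrix.smul_mul, trace_smul, smul_eq_mul] at h
    exact h
  have hsum := integral_add j1 (j2.const_mul θ)
  rw [integral_const_mul, hzero, mul_zero, add_zero] at hsum
  exact hsum.symm.le.trans hmono

/-- Independence replaces the square by its mean, which is at most `m‖S‖`; restoring the missing row
then only increases the trace. -/
lemma integral_trace_sq_mul_exp_erase_le (hm : 0 ≤ m) (ha : ∀ i, Measurable (a i))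
    (hb : ∀ᵐ ω ∂P, ∀ i, ‖a i ω‖ ≤ √m) (hind : iIndepFun a P) (θ : ℝ) (i : Fin N)
    (hS : ∫ ω, outer (a i ω) ∂P = S) :
    ∫ ω, ((outer (a i ω) - S) * (outer (a i ω) - S) *
      NormedSpace.exp (θ • centredGramErase S i fun j => a j ω)).trace ∂P ≤
      m * ‖S‖ * traceMgf P a S θ := by
  have hH := isHermitian_second_moment ha hb i hS
  have cX : Continuous fun v : EuclideanSpace ℝ (Fin n) => (outer v - S) * (outer v - S) :=
    (continuous_outer.sub continuous_const).mul (continuous_outer.sub continuous_const)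
  have cW := (continuous_centredGramErase S i).const_smul θ
  rw [integral_trace_mul_of_indep ha hb hind i cX
      (ψ := fun y => NormedSpace.exp (θ • centredGramErase S i y))
      (continuous_exp_matrix.comp cW) (fun y => by rw [centredGramErase_update])]
  have j1 : Integrable (fun ω => (NormedSpace.exp (θ • centredGramErase S i
      fun j => a j ω)).trace) P := integrable_comp_rows ha hb (continuous_trace_exp cW)
  have hps := posSemidef_norm_sub_variance hm ha hb i hS
  set V := ∫ ω, (outer (a i ω) - S) * (outer (a i ω) - S) ∂P with hV
  have j2 : Integrable (fun ω => (V *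
      NormedSpace.exp (θ • centredGramErase S i fun j => a j ω)).trace) P :=
    integrable_comp_rows ha hb (φ := fun y => (V *
      NormedSpace.exp (θ • centredGramErase S i y)).trace)
      (continuous_trace_mul_exp continuous_const cW)
  calc ∫ ω, (V * NormedSpace.exp (θ • centredGramErase S i fun j => a j ω)).trace ∂P
      ≤ ∫ ω, m * ‖S‖ * (NormedSpace.exp (θ • centredGramErase S i fun j => a j ω)).trace ∂P := by
        refine integral_mono j2 (j1.const_mul _) fun ω => ?_
        have hW : (centredGramErase S i fun j => a j ω).IsHermitian := isHermitian_sum hH _ _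
        have := trace_mul_exp_le hps (IsHermitian.real_smul hW θ)
        rwa [Matrix.smul_mul, Matrix.one_mul, trace_smul, smul_eq_mul] at this
    _ ≤ _ := by
        rw [integral_const_mul]
        exact mul_le_mul_of_nonneg_left (integral_trace_exp_erase_le ha hb hind θ i hS).1
          (mul_nonneg hm (norm_nonneg _))

/-- Here the squares are not independent of the exponential, so the pointwise self-bound is
integrated instead; the first integral on the right is the derivative of `traceMgf`. -/
lemma sum_integral_trace_sq_mul_exp_le (hN : 1 ≤ N) (hm : 0 ≤ m) (ha : ∀ i, Measurable (a i))
    (hb : ∀ᵐ ω ∂P, ∀ i, ‖a i ω‖ ≤ √m) (θ : ℝ) (hS : ∀ i, ∫ ω, outer (a i ω) ∂P = S) :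
    ∑ i, ∫ ω, ((outer (a i ω) - S) * (outer (a i ω) - S) *
      NormedSpace.exp (θ • centredGram S fun j => a j ω)).trace ∂P ≤
      2 * m * (∫ ω, (centredGram S (fun i => a i ω) *
        NormedSpace.exp (θ • centredGram S fun i => a i ω)).trace ∂P) +
      4 * (m * N * ‖S‖) * traceMgf P a S θ := by
  have hH := isHermitian_second_moment ha hb ⟨0, hN⟩ (hS _)
  have hSS := posSemidef_norm_sub_sq hm ha hb ⟨0, hN⟩ (hS _)
  have cX : ∀ i : Fin N, Continuous fun y : Fin N → EuclideanSpace ℝ (Fin n) =>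
      (outer (y i) - S) * (outer (y i) - S) := fun i =>
    ((continuous_outer_apply i).sub continuous_const).mul
      ((continuous_outer_apply i).sub continuous_const)
  have cZ := (continuous_centredGram (N := N) S).const_smul θ
  have j1 : ∀ i, Integrable (fun ω => ((outer (a i ω) - S) * (outer (a i ω) - S) *
      NormedSpace.exp (θ • centredGram S fun j => a j ω)).trace) P := fun i =>
    integrable_comp_rows ha hb (continuous_trace_mul_exp (cX i) cZ)
  have j2 : Integrable (fun ω => (centredGram S (fun i => a i ω) *
        NormedSpace.exp (θ • centredGram S fun i => a i ω)).trace) P :=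
    integrable_comp_rows ha hb (continuous_trace_mul_exp (continuous_centredGram S) cZ)
  have j3 : Integrable (fun ω => (NormedSpace.exp (θ • centredGram S
      fun j => a j ω)).trace) P := integrable_comp_rows ha hb (continuous_trace_exp cZ)
  rw [← integral_finsetSum _ fun i _ => j1 i, traceMgf, ← integral_const_mul,
    ← integral_const_mul, ← integral_add (j2.const_mul _) (j3.const_mul _)]
  refine integral_mono_ae (integrable_finsetSum _ fun i _ => j1 i)
    ((j2.const_mul _).add (j3.const_mul _)) ?_
  filter_upwards [hb] with ω hω
  have hZ : (centredGram S fun j => a j ω).IsHermitian := isHermitian_sum hH _ _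
  have := trace_mul_exp_le (posSemidef_self_bound hm hH hSS hω) (IsHermitian.real_smul hZ θ)
  rw [Finset.sum_mul, trace_sum, Matrix.add_mul, trace_add, Matrix.smul_mul, Matrix.smul_mul,
    Matrix.one_mul, trace_smul, trace_smul, smul_eq_mul, smul_eq_mul] at this
  exact this

/-- The self-bounding differential inequality for the trace moment generating function. -/
lemma mul_deriv_traceMgf_le (hN : 1 ≤ N) (hm : 0 ≤ m) (ha : ∀ i, Measurable (a i))
    (hb : ∀ᵐ ω ∂P, ∀ i, ‖a i ω‖ ≤ √m) (hind : iIndepFun a P)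
    (hS : ∀ i, ∫ ω, outer (a i ω) ∂P = S) {θ : ℝ} (hθ : θ * (4 * m) ≤ 1) :
    θ * (∫ ω, (centredGram S (fun i => a i ω) *
        NormedSpace.exp (θ • centredGram S fun i => a i ω)).trace ∂P) ≤
      10 * θ ^ 2 * (m * N * ‖S‖) * traceMgf P a S θ := by
  have hH := isHermitian_second_moment ha hb ⟨0, hN⟩ (hS _)
  have cX : ∀ i : Fin N, Continuous fun y : Fin N → EuclideanSpace ℝ (Fin n) =>
      outer (y i) - S := fun i => (continuous_outer_apply i).sub continuous_const
  have cZ := (continuous_centredGram (N := N) S).const_smul θ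
  have cW := fun i : Fin N => (continuous_centredGramErase S i).const_smul θ
  have j1 : ∀ i, Integrable (fun ω => ((outer (a i ω) - S) *
      NormedSpace.exp (θ • centredGram S fun j => a j ω)).trace) P := fun i =>
    integrable_comp_rows ha hb (continuous_trace_mul_exp (cX i) cZ)
  have j2 : ∀ i, Integrable (fun ω => ((outer (a i ω) - S) *
      NormedSpace.exp (θ • centredGramErase S i fun j => a j ω)).trace) P := fun i =>
    integrable_comp_rows ha hb (continuous_trace_mul_exp (cX i) (cW i))
  have j3 : ∀ i, Integrable (fun ω => ((outer (a i ω) - S) * (outer (a i ω) - S) *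
      NormedSpace.exp (θ • centredGram S fun j => a j ω)).trace) P := fun i =>
    integrable_comp_rows ha hb (continuous_trace_mul_exp ((cX i).mul (cX i)) cZ)
  have j4 : ∀ i, Integrable (fun ω => ((outer (a i ω) - S) * (outer (a i ω) - S) *
      NormedSpace.exp (θ • centredGramErase S i fun j => a j ω)).trace) P := fun i =>
    integrable_comp_rows ha hb (continuous_trace_mul_exp ((cX i).mul (cX i)) (cW i))
  have hQ0 : 0 ≤ traceMgf P a S θ := integral_nonneg fun ω =>
    trace_exp_nonneg (IsHermitian.real_smul (isHermitian_sum hH _ _) θ)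
  have hD := sum_integral_trace_sq_mul_exp_le hN hm ha hb θ hS
  set D := ∫ ω, (centredGram S (fun i => a i ω) *
        NormedSpace.exp (θ • centredGram S fun i => a i ω)).trace ∂P with hDdef
  set Q := traceMgf P a S θ
  have hDsum : D = ∑ i, ∫ ω, ((outer (a i ω) - S) *
      NormedSpace.exp (θ • centredGram S fun j => a j ω)).trace ∂P := by
    rw [← integral_finsetSum _ fun i _ => j1 i, hDdef]
    refine integral_congr_ae (.of_forall fun ω => ?_)
    simp only
    rw [← trace_sum, ← Finset.sum_mul]
    rfl
  have hi : ∀ i, θ * (∫ ω, ((outer (a i ω) - S) *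
      NormedSpace.exp (θ • centredGram S fun j => a j ω)).trace ∂P) ≤
      θ ^ 2 * (∫ ω, ((outer (a i ω) - S) * (outer (a i ω) - S) *
        NormedSpace.exp (θ • centredGram S fun j => a j ω)).trace ∂P) +
      θ ^ 2 * (m * ‖S‖ * Q) := by
    intro i
    have h1 := integral_mono (((j1 i).const_mul θ).sub ((j2 i).const_mul θ))
      (((j3 i).const_mul (θ ^ 2)).add ((j4 i).const_mul (θ ^ 2)))
      fun ω => trace_leave_one_out_le hH θ i fun j => a j ω
    have h2 := integral_sub ((j1 i).const_mul θ) ((j2 i).const_mul θ)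
    have h3 := integral_add ((j3 i).const_mul (θ ^ 2)) ((j4 i).const_mul (θ ^ 2))
    rw [integral_const_mul, integral_const_mul,
      (integral_trace_exp_erase_le ha hb hind θ i (hS i)).2, mul_zero, sub_zero] at h2
    rw [integral_const_mul, integral_const_mul] at h3
    have h4 := mul_le_mul_of_nonneg_left
      (integral_trace_sq_mul_exp_erase_le hm ha hb hind θ i (hS i)) (sq_nonneg θ)
    exact (h2.symm.le.trans (h1.trans h3.le)).trans (by gcongr)
  have hsum := Finset.sum_le_sum fun i (_ : i ∈ Finset.univ) => hi i
  rw [← Finset.mul_sum, ← hDsum, Finset.sum_add_distrib, ← Finset.mul_sum, Finset.sum_const,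
    Finset.card_univ, Fintype.card_fin, nsmul_eq_mul] at hsum
  have h5 := mul_le_mul_of_nonneg_left hD (sq_nonneg θ)
  have hK : 0 ≤ θ ^ 2 * (m * N * ‖S‖) * Q := by positivity
  -- The `5` is `4` from the self-bound plus `1` from the leave-one-out terms. The factor on the
  -- left is at least `1/2`; dividing by it matters only when `θ * D` is positive.
  have h6 : θ * D * (1 - 2 * (θ * m)) ≤ 5 * (θ ^ 2 * (m * N * ‖S‖) * Q) := by linarith
  by_cases h7 : θ * D ≤ 0
  · linarith
  · nlinarith [mul_nonneg (not_le.1 h7).le (show 0 ≤ 1 - θ * (4 * m) by linarith)]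

lemma traceMgf_zero : traceMgf P a S 0 = n := by
  simp [traceMgf]

/-- Integrating the differential inequality `s g' ≤ 2 L s² g`. -/
lemma le_mul_exp_sq_of_deriv_le {g g' : ℝ → ℝ} (hg : ∀ s, HasDerivAt g (g' s) s) {L R : ℝ}
    (h : ∀ s, 0 < s → s < R → s * g' s ≤ 2 * L * s ^ 2 * g s) (hR : 0 ≤ R) :
    g R ≤ g 0 * Real.exp (L * R ^ 2) := by
  have hd : ∀ s, HasDerivAt (fun s => g s * Real.exp (-(L * s ^ 2)))
      (g' s * Real.exp (-(L * s ^ 2)) + g s * (Real.exp (-(L * s ^ 2)) * (-(L * (2 * s))))) s := by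
    intro s
    refine (hg s).mul (HasDerivAt.exp ?_)
    simpa using (((hasDerivAt_id' s).fun_pow 2).const_mul L).fun_neg
  have hanti : AntitoneOn (fun s => g s * Real.exp (-(L * s ^ 2))) (Set.Icc 0 R) := by
    refine antitoneOn_of_deriv_nonpos (convex_Icc 0 R)
      (fun s _ => (hd s).continuousAt.continuousWithinAt)
      (fun s _ => (hd s).differentiableAt.differentiableWithinAt) fun s hs => ?_
    rw [interior_Icc] at hs
    rw [(hd s).deriv]
    have h1 := h s hs.1 hs.2
    have h2 : g' s ≤ 2 * L * s * g s := by
      refine le_of_mul_le_mul_left ?_ hs.1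
      linarith
    nlinarith [mul_le_mul_of_nonneg_right h2 (Real.exp_pos (-(L * s ^ 2))).le]
  have := hanti (Set.left_mem_Icc.2 hR) (Set.right_mem_Icc.2 hR) hR
  simp only [ne_eq, OfNat.ofNat_ne_zero, not_false_eq_true, zero_pow, mul_zero, neg_zero,
    Real.exp_zero, mul_one] at this
  calc g R = g R * Real.exp (-(L * R ^ 2)) * Real.exp (L * R ^ 2) := by
        rw [mul_assoc, ← Real.exp_add]; simp
    _ ≤ _ := by gcongr

lemma traceMgf_le (hN : 1 ≤ N) (hm : 0 ≤ m) (ha : ∀ i, Measurable (a i))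
    (hb : ∀ᵐ ω ∂P, ∀ i, ‖a i ω‖ ≤ √m) (hind : iIndepFun a P)
    (hS : ∀ i, ∫ ω, outer (a i ω) ∂P = S) {θ : ℝ} (hθ0 : 0 ≤ θ) (hθ : θ * (4 * m) ≤ 1) :
    traceMgf P a S θ ≤ n * Real.exp (5 * (m * N * ‖S‖) * θ ^ 2) ∧
    traceMgf P a S (-θ) ≤ n * Real.exp (5 * (m * N * ‖S‖) * θ ^ 2) := by
  constructor
  · rw [← traceMgf_zero (P := P) (a := a) (S := S)]
    refine le_mul_exp_sq_of_deriv_le (fun s => hasDerivAt_traceMgf ha hb s) (fun s h0 h1 => ?_) hθ0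
    have := mul_deriv_traceMgf_le hN hm ha hb hind hS (θ := s)
      ((mul_le_mul_of_nonneg_right h1.le (by positivity)).trans hθ)
    linarith
  · rw [← traceMgf_zero (P := P) (a := a) (S := S)]
    have := le_mul_exp_sq_of_deriv_le (g := fun s => traceMgf P a S (-s)) (R := θ)
      (L := 5 * (m * N * ‖S‖))
      (fun s => (hasDerivAt_traceMgf ha hb (-s)).scomp s (hasDerivAt_neg s)) (fun s h0 h1 => ?_) hθ0
    · simpa using this
    -- For a negative parameter the smallness condition is automatic.
    · have := mul_deriv_traceMgf_le hN hm ha hb hind hS (θ := -s)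
        (by nlinarith [mul_nonneg h0.le hm])
      rw [neg_sq] at this
      rw [smul_eq_mul]
      linarith

/-- Markov's inequality for the trace moment generating function. -/
lemma measureReal_lt_norm_centredGram_le (hN : 1 ≤ N) (hm : 0 ≤ m) (ha : ∀ i, Measurable (a i))
    (hb : ∀ᵐ ω ∂P, ∀ i, ‖a i ω‖ ≤ √m) (hind : iIndepFun a P)
    (hS : ∀ i, ∫ ω, outer (a i ω) ∂P = S) {θ s : ℝ} (hθ0 : 0 ≤ θ) (hθ : θ * (4 * m) ≤ 1)
    (hs : 0 ≤ s) :
    P.real {ω | s < ‖centredGram S fun i => a i ω‖} ≤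
      2 * n * Real.exp (5 * (m * N * ‖S‖) * θ ^ 2 - θ * s) := by
  have hH := isHermitian_second_moment ha hb ⟨0, hN⟩ (hS _)
  have j : ∀ θ : ℝ, Integrable (fun ω => (NormedSpace.exp (θ • centredGram S
      fun j => a j ω)).trace) P := fun θ =>
    integrable_comp_rows ha hb (continuous_trace_exp ((continuous_centredGram S).const_smul θ))
  have hnn : ∀ (θ : ℝ) ω, 0 ≤ (NormedSpace.exp (θ • centredGram S fun j => a j ω)).trace :=
    fun θ ω => trace_exp_nonneg (IsHermitian.real_smul (isHermitian_sum hH _ _) θ)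
  have hmk := mul_meas_ge_le_integral_of_nonneg (μ := P)
    (.of_forall fun ω => add_nonneg (hnn θ ω) (hnn (-θ) ω)) ((j θ).add (j (-θ))) (Real.exp (θ * s))
  have hint := integral_add (j θ) (j (-θ))
  have hbd := traceMgf_le hN hm ha hb hind hS hθ0 hθ
  have hle : Real.exp (θ * s) * P.real {ω | s < ‖centredGram S fun i => a i ω‖} ≤
      2 * n * Real.exp (5 * (m * N * ‖S‖) * θ ^ 2) := by
    calc _ ≤ _ := mul_le_mul_of_nonneg_left (measureReal_mono fun ω hω =>
          exp_le_trace_exp_add_trace_exp (isHermitian_sum hH _ _) hθ0 hs hω) (Real.exp_pos _).le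
      _ ≤ _ := hmk
      _ = traceMgf P a S θ + traceMgf P a S (-θ) := hint
      _ ≤ _ := by linarith [hbd.1, hbd.2]
  rw [Real.exp_sub, ← mul_div_assoc, le_div_iff₀ (Real.exp_pos _)]
  linarith

end RandomRows

/-! ### Optimising the tail bound and passing to the norm of the matrix -/

namespace RandomRows
open Matrix

variable {n N : ℕ} {Ω : Type*} [MeasurableSpace Ω] {P : Measure Ω} [IsProbabilityMeasure P]
  {a : Fin N → Ω → EuclideanSpace ℝ (Fin n)} {m : ℝ} {S : Matrix (Fin n) (Fin n) ℝ}

lemma mul_sqrt_mul_sqrt_div (hN : 1 ≤ N) (hm : 0 ≤ m) (σ : ℝ) (hσ : 0 ≤ σ) :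
    N * (√σ * √(m / N)) = √(m * N * σ) := by
  have hN' : (0 : ℝ) < N := by exact_mod_cast hN
  rw [← Real.sqrt_mul hσ, eq_comm, Real.sqrt_eq_iff_mul_self_eq (by positivity) (by positivity)]
  have := Real.mul_self_sqrt (show 0 ≤ σ * (m / N) by positivity)
  symm
  calc N * √(σ * (m / N)) * (N * √(σ * (m / N)))
      = N * N * (√(σ * (m / N)) * √(σ * (m / N))) := by ring
    _ = m * N * σ := by rw [this]; field_simp

lemma mul_sq_deviation (hN : 1 ≤ N) (hm : 0 ≤ m) (t : ℝ) : N * (t * √(m / N)) ^ 2 = t ^ 2 * m := by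
  have hN' : (0 : ℝ) < N := by exact_mod_cast hN
  rw [mul_pow, Real.sq_sqrt (by positivity)]
  field_simp

/-- Almost surely vanishing rows have vanishing centred Gram matrix. -/
lemma measureReal_norm_centredGram_pos_eq_zero (hN : 1 ≤ N)
    (hb : ∀ᵐ ω ∂P, ∀ i, ‖a i ω‖ ≤ √0) (hS : ∀ i, ∫ ω, outer (a i ω) ∂P = S) :
    P.real {ω | 0 < ‖centredGram S fun i => a i ω‖} = 0 := by
  have h0 : ∀ᵐ ω ∂P, ∀ i, outer (a i ω) = 0 := by
    filter_upwards [hb] with ω hω i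
    have : a i ω = 0 := norm_le_zero_iff.1 (by simpa using hω i)
    ext j k
    simp [this, outer_apply]
  have hS0 : S = 0 := by
    rw [← hS ⟨0, hN⟩]
    exact integral_eq_zero_of_ae (h0.mono fun ω h => h _)
  rw [measureReal_eq_zero_iff]
  refine measure_mono_null (fun ω hω => ?_) h0
  intro hc
  have hz : ∀ i, outer (a i ω) = 0 := hc
  simp [centredGram, hz, hS0] at hω

lemma measureReal_deviation_le (hN : 1 ≤ N) (hm : 0 ≤ m) (ha : ∀ i, Measurable (a i))
    (hb : ∀ᵐ ω ∂P, ∀ i, ‖a i ω‖ ≤ √m) (hind : iIndepFun a P)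
    (hS : ∀ i, ∫ ω, outer (a i ω) ∂P = S) {t : ℝ} (ht : 0 < t) :
    P.real {ω | N * max (√‖S‖ * (t * √(m / N))) ((t * √(m / N)) ^ 2) <
      ‖centredGram S fun i => a i ω‖} ≤ 2 * n * Real.exp (-(t ^ 2 / 20)) := by
  have hN' : (0 : ℝ) < N := by exact_mod_cast hN
  -- For `m = 0` the threshold is zero and the choices of `θ` below degenerate.
  rcases hm.eq_or_lt with rfl | hm'
  · refine le_trans (le_of_eq ?_) (by positivity)
    simpa using measureReal_norm_centredGram_pos_eq_zero hN hb hS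
  have hs1 : t * √(m * N * ‖S‖) ≤ N * max (√‖S‖ * (t * √(m / N))) ((t * √(m / N)) ^ 2) := by
    rw [← mul_sqrt_mul_sqrt_div hN hm _ (norm_nonneg _)]
    calc _ = N * (√‖S‖ * (t * √(m / N))) := by ring
      _ ≤ _ := by gcongr; exact le_max_left _ _
  have hs2 : t ^ 2 * m ≤ N * max (√‖S‖ * (t * √(m / N))) ((t * √(m / N)) ^ 2) := by
    rw [← mul_sq_deviation hN hm]
    gcongr; exact le_max_right _ _
  have hs0 := (show 0 ≤ t ^ 2 * m by positivity).trans hs2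
  set s := N * max (√‖S‖ * (t * √(m / N))) ((t * √(m / N)) ^ 2)
  have hK : 0 ≤ m * N * ‖S‖ := by positivity
  suffices ∃ θ : ℝ, 0 ≤ θ ∧ θ * (4 * m) ≤ 1 ∧
      5 * (m * N * ‖S‖) * θ ^ 2 - θ * s ≤ -(t ^ 2 / 20) by
    obtain ⟨θ, h0, h1, h2⟩ := this
    refine (measureReal_lt_norm_centredGram_le hN hm ha hb hind hS h0 h1 hs0).trans ?_
    gcongr
  set k := √(m * N * ‖S‖) with hk
  have hkk : m * N * ‖S‖ = k ^ 2 := (Real.sq_sqrt hK).symm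
  rw [hkk]
  -- The choice is `θ = t/(10k)` (Gaussian regime, using `s ≥ t k`), capped at `1/(10m)` (using `s ≥
  -- t² m`). Either way the linear gain is at least `t²/10` and the quadratic loss at most `t²/20`.
  rcases le_or_gt (t * m) k with h | h
  · have hk0 : 0 < k := (mul_pos ht hm').trans_le h
    refine ⟨t / (10 * k), by positivity, ?_, ?_⟩
    · rw [div_mul_eq_mul_div, div_le_one (by positivity)]
      linarith
    · have h1 : t / (10 * k) * (t * k) ≤ t / (10 * k) * s := by gcongr
      have h2 : t / (10 * k) * (t * k) = t ^ 2 / 10 := by field_simp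
      have h3 : 5 * k ^ 2 * (t / (10 * k)) ^ 2 = t ^ 2 / 20 := by field_simp; norm_num
      linarith
  · refine ⟨1 / (10 * m), by positivity, ?_, ?_⟩
    · rw [div_mul_eq_mul_div, div_le_one (by positivity)]
      linarith
    · have h1 : 1 / (10 * m) * (t ^ 2 * m) ≤ 1 / (10 * m) * s := by gcongr
      have h2 : 1 / (10 * m) * (t ^ 2 * m) = t ^ 2 / 10 := by field_simp
      have h3 : 5 * k ^ 2 * (1 / (10 * m)) ^ 2 ≤ 5 * (t * m) ^ 2 * (1 / (10 * m)) ^ 2 := by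
        gcongr
      have h4 : 5 * (t * m) ^ 2 * (1 / (10 * m)) ^ 2 = t ^ 2 / 20 := by field_simp; norm_num
      linarith

lemma conjTranspose_mul_self_eq_sum_outer (A : Matrix (Fin N) (Fin n) ℝ) :
    Aᴴ * A = ∑ i, outer (WithLp.toLp 2 (A i)) := by
  ext j k
  simp [mul_apply, Matrix.sum_apply, outer_apply]

lemma norm_sample_sub_eq (hN : 1 ≤ N) (A : Matrix (Fin N) (Fin n) ℝ) :
    ‖(1 / (N : ℝ)) • (Aᴴ * A) - S‖ = ‖centredGram S fun i => WithLp.toLp 2 (A i)‖ / N := by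
  have hN' : (0 : ℝ) < N := by exact_mod_cast hN
  have : (1 / (N : ℝ)) • (Aᴴ * A) - S =
      (1 / (N : ℝ)) • centredGram S fun i => WithLp.toLp 2 (A i) := by
    rw [centredGram, Finset.sum_sub_distrib, ← conjTranspose_mul_self_eq_sum_outer, smul_sub,
      Finset.sum_const, Finset.card_univ, Fintype.card_fin, ← Nat.cast_smul_eq_nsmul ℝ, smul_smul,
      one_div, inv_mul_cancel₀ hN'.ne', one_smul]
  rw [this, norm_smul, Real.norm_of_nonneg (by positivity)]
  ring

lemma integral_outer_eq (ha : ∀ i, Measurable (a i))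
    (hb : ∀ᵐ ω ∂P, ∀ i, ‖a i ω‖ ≤ √m) (i : Fin N) :
    ∫ ω, outer (a i ω) ∂P = secondMomentMatrix P (a i) := by
  ext j k
  rw [integral_entry (integrable_comp_rows ha hb (continuous_outer_apply i))]
  rfl

/-- A covariance estimate controls the operator norm of the matrix. -/
lemma norm_le_of_norm_sample_sub_le (hN : 1 ≤ N) {t : ℝ} (ht : 0 ≤ t)
    (A : Matrix (Fin N) (Fin n) ℝ)
    (h : ‖(1 / (N : ℝ)) • (Aᴴ * A) - S‖ ≤
      max (√‖S‖ * (t * √(m / N))) ((t * √(m / N)) ^ 2)) :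
    ‖A‖ ≤ √‖S‖ * √N + t * √m := by
  have hN' : (0 : ℝ) < N := by exact_mod_cast hN
  set δ := t * √(m / N) with hδ
  have hδ0 : 0 ≤ δ := by positivity
  -- Completing the square: the maximum is at most `2√‖S‖ δ + δ²`.
  have h1 : ‖(1 / (N : ℝ)) • (Aᴴ * A)‖ ≤ (√‖S‖ + δ) ^ 2 := by
    have h2 := norm_le_norm_sub_add ((1 / (N : ℝ)) • (Aᴴ * A)) S
    have h3 := Real.sq_sqrt (norm_nonneg S)
    have h4 : max (√‖S‖ * δ) (δ ^ 2) ≤ 2 * (√‖S‖ * δ) + δ ^ 2 := by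
      have : 0 ≤ √‖S‖ * δ := by positivity
      refine max_le ?_ ?_ <;> nlinarith [sq_nonneg δ]
    nlinarith
  rw [norm_smul, Real.norm_of_nonneg (by positivity), l2_opNorm_conjTranspose_mul_self,
    one_div, inv_mul_le_iff₀ hN'] at h1
  have h5 : √‖S‖ * √N + t * √m = √N * (√‖S‖ + δ) := by
    rw [hδ, mul_add, ← mul_assoc, mul_comm √(N : ℝ) t, mul_assoc t, ← Real.sqrt_mul hN'.le (m / N),
      mul_div_cancel₀ _ hN'.ne']
    ring
  rw [h5]
  refine abs_le_of_sq_le_sq' ?_ (by positivity) |>.2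
  rw [mul_pow, Real.sq_sqrt hN'.le]
  linarith

end RandomRows

/-! ### The main theorem -/

theorem mainTheorem3 :
    ∃ c : ℝ, 0 < c ∧
      ∀ {Ω : Type*} [MeasurableSpace Ω] (P : Measure Ω) [IsProbabilityMeasure P]
        (N n : ℕ) (_hN : 1 ≤ N)
        (A : Ω → Matrix (Fin N) (Fin n) ℝ)
        (_hmeas : ∀ i, Measurable (randomRow A i))
        (_hindep : iIndepFun (fun i => randomRow A i) P)
        (S : Matrix (Fin n) (Fin n) ℝ)
        (_hS : ∀ i, secondMomentMatrix P (randomRow A i) = S)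
        (m : ℝ) (_hm : 0 ≤ m)
        (_hbound : ∀ i, ∀ᵐ ω ∂P, ‖randomRow A i ω‖ ≤ √m)
        (t : ℝ) (_ht : 0 ≤ t) (δ : ℝ) (_hδ : δ = t * √(m / N)),
        1 - (max n 2 : ℝ) * Real.exp (-c * t ^ 2) ≤
          P.real {ω | ‖(1 / (N : ℝ)) • ((A ω)ᴴ * A ω) - S‖ ≤ max (√‖S‖ * δ) (δ ^ 2)} ∧
        ∀ ω, ‖(1 / (N : ℝ)) • ((A ω)ᴴ * A ω) - S‖ ≤ max (√‖S‖ * δ) (δ ^ 2) →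
          ‖A ω‖ ≤ √‖S‖ * √N + t * √m := by
  refine ⟨1 / 40, by norm_num, ?_⟩
  intro Ω _ P _ N n hN A hmeas hindep S hS m hm hbound t ht δ hδ
  subst hδ
  refine ⟨?_, fun ω hω => RandomRows.norm_le_of_norm_sample_sub_le hN ht (A ω) hω⟩
  have hM2 : (2 : ℝ) ≤ max (n : ℝ) 2 := le_max_right _ _
  have hMn : (n : ℝ) ≤ max (n : ℝ) 2 := le_max_left _ _
  rcases ht.eq_or_lt with rfl | ht'
  · refine le_trans ?_ measureReal_nonneg
    norm_num
  have hN' : (0 : ℝ) < N := by exact_mod_cast hN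
  have hb : ∀ᵐ ω ∂P, ∀ i, ‖randomRow A i ω‖ ≤ √m := ae_all_iff.2 hbound
  have hS' : ∀ i, ∫ ω, Matrix.outer (randomRow A i ω) ∂P = S := fun i =>
    (RandomRows.integral_outer_eq hmeas hb i).trans (hS i)
  have hdev := RandomRows.measureReal_deviation_le hN hm hmeas hb hindep hS' ht'
  -- The two events cover the space; subadditivity avoids measurability questions about a
  -- complement.
  have hunion : (1 : ℝ) ≤
      P.real {ω | ‖(1 / (N : ℝ)) • ((A ω)ᴴ * A ω) - S‖ ≤
        max (√‖S‖ * (t * √(m / N))) ((t * √(m / N)) ^ 2)} +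
      P.real {ω | N * max (√‖S‖ * (t * √(m / N))) ((t * √(m / N)) ^ 2) <
        ‖RandomRows.centredGram S fun i => randomRow A i ω‖} := by
    refine le_trans ?_ (measureReal_union_le _ _)
    refine (probReal_univ (μ := P)).symm.le.trans (measureReal_mono fun ω _ => ?_)
    rw [Set.mem_union, Set.mem_ofPred_eq, Set.mem_ofPred_eq, RandomRows.norm_sample_sub_eq hN,
      div_le_iff₀ hN', mul_comm (max _ _)]
    exact le_or_gt _ _
  have hx : Real.exp (-(t ^ 2 / 20)) = Real.exp (-(1 / 40) * t ^ 2) ^ 2 := by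
    rw [← Real.exp_nat_mul]; congr 1; push_cast; ring
  rw [hx] at hdev
  have hx0 := Real.exp_pos (-(1 / 40) * t ^ 2)
  set x := Real.exp (-(1 / 40) * t ^ 2)
  set M := max (n : ℝ) 2
  -- If `M x ≥ 1` the claim is trivial; otherwise `2n x² ≤ (M x)² ≤ M x`. This is why `c` is half of
  -- `1/20`.
  rcases le_or_gt 1 (M * x) with h | h
  · exact le_trans (by linarith) measureReal_nonneg
  · have h1 : 2 * (n : ℝ) ≤ M * M := by gcongr
    have h2 : 2 * (n : ℝ) * x ^ 2 ≤ M * M * x ^ 2 := by gcongr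
    nlinarith [mul_pos (zero_lt_two.trans_le hM2) hx0]
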